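/- Let $M=2$ and $\beta=2$: a server stores two files $X^{(1)},X^{(2)}$, independent and uniformly distributed on $\{0,1\}^2$, and a user wants the file with index $m$, where $m$ is uniform on $\{1,2\}$. A scheme consists of a finite set $\mathcal Q$ of queries, conditional probabilities $P(q\mid m)$ ($q\in\mathcal Q$, $m\in\{1,2\}$), a deterministic response $A_q=A(q,X^{(1)},X^{(2)})$ of the server to each query $q$, and a reconstruction $\hat X^{(m)}(q,A_q)\in\{0,1\}^2$ of the desired file. For each $q$ the response $A_q$ is encoded with an optimal binary prefix (Huffman) code; let $\ell^*_q$ be its expected codeword length in bits (so $\ell^*_q=0$ if $A_q$ is constant). The scheme has * rate $R=\frac1\beta\sum_{q}P(q)\,\ell^*_q$, where $P(q)=\frac12\bigl(P(q\mid1)+P(q\mid2)\bigr)$; * distortion equal to the average, over $m$, of the expected fraction of incorrectly reconstructed bits of $X^{(m)}$, that is $\frac12\sum_{m=1}^{2}\sum_{q}P(q\mid m)\,\frac1\beta\sum_{i=1}^{\beta}\Pr\bigl[\hat X^{(m)}_i(q,A_q)\neq X^{(m)}_i\bigr]$; * leakage $\frac12\sum_{q}\max_{m}P(q\mid m)$,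 the probability that the server's maximum-likelihood guess of $m$ from $q$ is correct. Let $R^*(D,L)$ be the minimum rate over all schemes with distortion at most $D$ and leakage at most $L$. Then for every $L\in[\frac12,1]$ and $D\in[0,\frac12]$ the minimum is attained, and $$ R^*(D,L)=\begin{cases} -\frac{11}{2}D+3-2L & \text{if } D\in\left[0,\frac{1-L}{4}\right],\\[1mm] -5D+\frac{23-15L}{8} & \text{if } D\in\left[\frac{1-L}{4},\frac{3(1-L)}{8}\right],\\[1mm] -4D+\frac{5-3L}{2} & \text{if } D\in\left[\frac{3(1-L)}{8},\frac{5(1-L)}{8}\right],\\[1mm] -\frac83D+\frac{5-2L}{3} & \text{if } D\in\left[\frac{5(1-L)}{8},1-L\right],\\[1mm] -2D+1 & \text{if } D\in\left[1-L,\frac12\right]. \end{cases} $$ -/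

import Mathlib

open scoped BigOperators

noncomputable section

/-- A binary code `c` is prefix-free on the set `T` of source symbols: the codewords of distinct
symbols of `T` are not prefixes of each other (in particular they are distinct). The empty word is
an admissible codeword, but then it is the only one. -/
def PrefixFreeOn {α : Type*} (c : α → List Bool) (T : Set α) : Prop :=
  ∀ a ∈ T, ∀ b ∈ T, a ≠ b → ¬ c a <+: c b

/-- The expected codeword length, in bits, of the encoding `c` of the random variable `f ω`, where
`ω` is uniformly distributed on the finite set `Ω`. -/
def expectedLength {Ω α : Type*} [Fintype Ω] (f : Ω → α) (c : α → List Bool) : ℝ :=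
  (∑ ω, ((c (f ω)).length : ℝ)) / Fintype.card Ω

/-- The expected codeword length in an optimal (Huffman) binary prefix code for the random
variable `f ω`, `ω` uniform on `Ω`. Only values that `f` takes receive a codeword. -/
def optimalLength {Ω α : Type*} [Fintype Ω] (f : Ω → α) : ℝ :=
  sInf {r : ℝ | ∃ c : α → List Bool, PrefixFreeOn c (Set.range f) ∧ r = expectedLength f c}

/-- Prefix codes for a finite source exist, and an optimal one is attained. -/
theorem optimalLength_attained {Ω α : Type*} [Fintype Ω] (f : Ω → α) :
    IsLeast {r : ℝ | ∃ c : α → List Bool, PrefixFreeOn c (Set.range f) ∧ r = expectedLength f c}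
      (optimalLength f) := by
  classical
  -- a code by unary words
  have hex : ∃ n : ℕ, ∃ c : α → List Bool, PrefixFreeOn c (Set.range f) ∧
      n = ∑ ω, (c (f ω)).length := by
    have hfin : (Set.range f).Finite := Set.finite_range f
    obtain ⟨g, hg⟩ : ∃ g : α → ℕ, Set.InjOn g (Set.range f) :=
      Set.countable_iff_exists_injOn.1 hfin.countable
    refine ⟨_, fun a => List.replicate (g a) true ++ [false], ?_, rfl⟩
    intro a ha b hb hab hpre
    apply hab
    apply hg ha hb
    rw [List.prefix_iff_getElem?] at hpre
    by_contra hne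
    rcases lt_or_gt_of_ne hne with h | h
    · have := hpre (g a) (by simp)
      simp [List.getElem?_append, h] at this
    · have := hpre (g b) (by simp; omega)
      simp [h] at this
  obtain ⟨c, hc, hn⟩ := Nat.find_spec hex
  have hl : IsLeast {r : ℝ | ∃ c : α → List Bool,
      PrefixFreeOn c (Set.range f) ∧ r = expectedLength f c} (expectedLength f c) := by
    refine ⟨⟨c, hc, rfl⟩, ?_⟩
    rintro r ⟨c', hc', rfl⟩
    have h := Nat.find_min' hex ⟨c', hc', rfl⟩
    rw [hn] at h
    unfold expectedLength
    have h' : (∑ ω, ((c (f ω)).length : ℝ)) ≤ ∑ ω, ((c' (f ω)).length : ℝ) := by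
      exact_mod_cast h
    exact div_le_div_of_nonneg_right h' (Nat.cast_nonneg _)
  have he : optimalLength f = expectedLength f c := hl.csInf_eq
  rw [he]
  exact hl

/-- The contents of a database of `M` files of `β` symbols each, over the alphabet `X`. -/
abbrev Database (X : Type) (M β : ℕ) : Type := Fin M → Fin β → X

/-- A single-server scheme for lossy and weakly private information retrieval of one out of `M`
files of `β` symbols over the alphabet `X` (which is also the reconstruction alphabet). -/
structure LWPIRScheme (X : Type) (M β : ℕ) where
  /-- the finite set of queries -/
  Query : Type
  [fintypeQuery : Fintype Query]
  /-- the set of responses -/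
  Answer : Type
  /-- `prob q m` is the conditional probability `P(q | m)` of the query `q` when the file with
  index `m` is desired -/
  prob : Query → Fin M → ℝ
  prob_nonneg : ∀ q m, 0 ≤ prob q m
  prob_sum : ∀ m, ∑ q, prob q m = 1
  /-- the response of the server -/
  answer : Query → Database X M β → Answer
  /-- `estimate m q a` is the user's reconstruction of the file `m` from the query `q` and the
  response `a` -/
  estimate : Fin M → Query → Answer → Fin β → X

attribute [instance] LWPIRScheme.fintypeQuery

namespace LWPIRScheme

variable {X : Type} [Fintype X] {M β : ℕ}

/-- The probability `P(q)` of the query `q` when the index of the desired file is uniform. -/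
def queryProb (S : LWPIRScheme X M β) (q : S.Query) : ℝ :=
  (∑ m, S.prob q m) / M

/-- The download rate: the expected length of the losslessly encoded response, per symbol of a
file. The response is encoded with an optimal code that depends on the query; the files are
independent and uniform. -/
def rate (S : LWPIRScheme X M β) : ℝ :=
  (∑ q, S.queryProb q * optimalLength (S.answer q)) / β

/-- The expected distortion `D⁽ᵐ⁾` of the file `m` with respect to the per-symbol distortion
function `d`, when the file `m` is desired and the files are independent and uniform. -/
def fileDistortion (S : LWPIRScheme X M β) (d : X → X → ℝ) (m : Fin M) : ℝ :=
  (∑ i : Fin β, ∑ q, S.prob q m *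
    ((∑ x : Database X M β, d (x m i) (S.estimate m q (S.answer q x) i)) /
      Fintype.card (Database X M β))) / β

/-- The average distortion, for a uniform index of the desired file. -/
def distortion (S : LWPIRScheme X M β) (d : X → X → ℝ) : ℝ :=
  (∑ m, S.fileDistortion d m) / M

/-- The leakage: the probability that the server's maximum-likelihood guess of the index of the
desired file from the query is correct. -/
def leakage (S : LWPIRScheme X M β) : ℝ :=
  (∑ q, ⨆ m, S.prob q m) / M

end LWPIRScheme

/-- The Hamming distortion. -/
def hammingDistortion {X : Type} [DecidableEq X] (x y : X) : ℝ :=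
  if x = y then 0 else 1

/-- `R` is the minimum download rate over all schemes for `M` files of `β` symbols over the
alphabet `X` whose distortion is at most `D` and whose leakage is at most `L`. -/
def IsMinimumRate (X : Type) [Fintype X] (d : X → X → ℝ) (M β : ℕ) (D L R : ℝ) : Prop :=
  IsLeast {r : ℝ | ∃ S : LWPIRScheme X M β,
    S.distortion d ≤ D ∧ S.leakage ≤ L ∧ S.rate = r} R

end

/-!
The set of attainable triples of distortion, leakage and rate is convex, since schemes can be mixed,
so the theorem says that its lower boundary consists of five planes. The extreme points are the
direct download of the desired file and five queries that do not depend on the desired file. The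
latter partition the cube of the 16 databases into cells and send the index of the cell with a
Huffman code; for their total numbers `E` of bit errors and `Λ` of code bits over all databases,
`(E, Λ)` is `(0, 64)`, `(8, 42)`, `(12, 32)`, `(20, 16)`, `(32, 0)`. Mixtures of them
(`mixedScheme`) attain the five planes.

For the converse, `LWPIRScheme.le_rate_add_distortion_add_leakage` reduces a supporting plane to two
inequalities about a single query, one for a query that reveals the file completely and one for a
query that reveals nothing. The first always follows from `Λ + 2 Eₘ ≥ 32`, where `Eₘ` counts the
errors in file `m`. The second is, for the first four planes, one of `4 Λ + 11 E ≥ 256`,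
`2 Λ + 5 E ≥ 124`, `Λ + 2 E ≥ 56`, `3 Λ + 4 E ≥ 128`.

These inequalities are proved by induction on the code tree
(`potential_le_sum_length_add_cost`). As `Λ` is the sum, over the inner nodes of the tree, of the
numbers of databases that pass through the node, a lower bound for the cost at the root follows from
a function of these numbers that is compatible with splitting a node in two, and that is below the
number of errors of a cell of the given size. For three of the inequalities the size of a cell is
all that is needed. The other two depend on the packing of cells: a cell with all five points of a
ball of radius one is too good, there can be at most two such cells, and two of them spoil every
other cell. The centres of these balls are marked, and the function depends also on the number of
marked databases that pass through the node (`le_of_two_full_balls`,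
`le_of_subsingleton_full_balls`).
-/

/-! ### Prefix codes and potentials -/

open Finset in
/-- Lower bounds for prefix codes by induction on the code tree. The words `w x` of the source
symbols `x ∈ S` that pass through a node of the tree either all end there, and then `f` is constant
on `S`, or `S` splits into the two sets below the children and each word loses its first letter.
A function `G` of the numbers of marked (elements of `Z`) and of all symbols that is bounded by the
total cost at the leaves, and that grows by at most `p` per symbol from the two children to their
parent, is therefore a lower bound for `p` times the total word length plus the total cost. -/
theorem potential_le_sum_length_add_cost {Ω α : Type*} [DecidableEq Ω] (p N : ℕ) (Z : Finset Ω)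
    (G : ℕ → ℕ → ℕ) (f : Ω → α) (cost : Ω → ℕ)
    (hzero : G 0 0 = 0)
    (hsplit : ∀ z₁ z₂ t₁ t₂, z₁ + z₂ ≤ #Z → t₁ + t₂ ≤ N → z₁ ≤ t₁ → z₂ ≤ t₂ →
      G (z₁ + z₂) (t₁ + t₂) ≤ p * (t₁ + t₂) + G z₁ t₁ + G z₂ t₂)
    (hleaf : ∀ S : Finset Ω, S.Nonempty → #S ≤ N → (∀ x ∈ S, ∀ x' ∈ S, f x = f x') →
      G #(S ∩ Z) #S ≤ ∑ x ∈ S, cost x)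
    (n : ℕ) (w : Ω → List Bool) (S : Finset Ω) (hS : #S ≤ N)
    (hlen : ∀ x ∈ S, (w x).length ≤ n)
    (hw : ∀ x ∈ S, ∀ x' ∈ S, w x <+: w x' → f x = f x') :
    G #(S ∩ Z) #S ≤ ∑ x ∈ S, (p * (w x).length + cost x) := by
  induction n generalizing w S with
  | zero =>
    rcases S.eq_empty_or_nonempty with rfl | hne
    · simp [hzero]
    · have hnil : ∀ x ∈ S, w x = [] := fun x hx => List.length_eq_zero_iff.1 (by
        simpa using hlen x hx)
      refine (hleaf S hne hS fun x hx x' hx' => hw x hx x' hx' (by simp [hnil x hx])).trans ?_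
      exact sum_le_sum fun x _ => Nat.le_add_left _ _
  | succ n ih =>
    by_cases h0 : ∃ x₀ ∈ S, w x₀ = []
    · obtain ⟨x₀, hx₀, hx₀'⟩ := h0
      have hc : ∀ x ∈ S, f x₀ = f x := fun x hx => hw x₀ hx₀ x hx (by simp [hx₀'])
      refine (hleaf S ⟨x₀, hx₀⟩ hS fun x hx x' hx' => (hc x hx).symm.trans (hc x' hx')).trans ?_
      exact sum_le_sum fun x _ => Nat.le_add_left _ _
    · push Not at h0
      have key : ∀ b : Bool, G #(S.filter (fun x => (w x).head? = some b) ∩ Z)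
          #(S.filter fun x => (w x).head? = some b) ≤
          ∑ x ∈ S.filter (fun x => (w x).head? = some b),
            (p * (w x).tail.length + cost x) := by
        intro b
        refine ih (fun x => (w x).tail) _ ((card_filter_le _ _).trans hS) ?_ ?_
        · intro x hx
          have := hlen x (mem_filter.1 hx).1
          simp only [List.length_tail]
          omega
        · intro x hx x' hx' hpre
          rw [mem_filter] at hx hx'
          refine hw x hx.1 x' hx'.1 ?_
          have hcons : ∀ v : List Bool, v.head? = some b → v = b :: v.tail := by
            intro v hv
            cases v <;> simp_all
          rw [hcons _ hx.2, hcons _ hx'.2]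
          exact (List.prefix_cons_inj b).2 hpre
      have hcompl : S.filter (fun x => ¬ (w x).head? = some true) =
          S.filter (fun x => (w x).head? = some false) := by
        refine filter_congr fun x hx => ?_
        have := h0 x hx
        revert this
        cases w x with
        | nil => simp
        | cons b v => cases b <;> simp
      have hsum : ∀ g : Ω → ℕ, ∑ x ∈ S, g x =
          ∑ x ∈ S.filter (fun x => (w x).head? = some true), g x +
          ∑ x ∈ S.filter (fun x => (w x).head? = some false), g x := by
        intro g
        rw [← hcompl, sum_filter_add_sum_filter_not]
      have hcard : #S = #(S.filter fun x => (w x).head? = some true) +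
          #(S.filter fun x => (w x).head? = some false) := by
        simpa using hsum fun _ => 1
      have hcardZ : #(S ∩ Z) = #(S.filter (fun x => (w x).head? = some true) ∩ Z) +
          #(S.filter (fun x => (w x).head? = some false) ∩ Z) := by
        simpa [← Finset.card_filter, filter_mem_eq_inter] using hsum fun x => if x ∈ Z then 1 else 0
      have hlong : ∑ x ∈ S, (p * (w x).length + cost x) =
          p * #S + ∑ x ∈ S, (p * (w x).tail.length + cost x) := by
        rw [mul_comm, ← smul_eq_mul, ← sum_const, ← sum_add_distrib]
        refine sum_congr rfl fun x hx => ?_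
        have := List.length_pos_iff.2 (h0 x hx)
        rw [show (w x).length = (w x).tail.length + 1 by rw [List.length_tail]; omega]
        ring
      have hG := hsplit #(S.filter (fun x => (w x).head? = some true) ∩ Z)
        #(S.filter (fun x => (w x).head? = some false) ∩ Z)
        #(S.filter fun x => (w x).head? = some true)
        #(S.filter fun x => (w x).head? = some false)
        (hcardZ ▸ card_le_card inter_subset_right) (hcard ▸ hS)
        (card_le_card inter_subset_left) (card_le_card inter_subset_left)
      rw [← hcard, ← hcardZ] at hG
      have h1 := key true
      have h2 := key false
      rw [hlong, hsum]
      omega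

/-! ### Bit errors in the database of four bits -/

/-- The number of bits of file `m` in which the reconstruction `y` differs from the database
`x`. -/
def fileErrors (m : Fin 2) (y x : Database Bool 2 2) : ℕ :=
  ∑ i, if x m i = y m i then 0 else 1

/-- The number of bits in which the reconstruction `y` of both files differs from the database `x`,
that is, the Hamming distance on the cube of dimension four. -/
def bitErrors (y x : Database Bool 2 2) : ℕ :=
  ∑ m, fileErrors m y x

open Finset in
/-- A set has few elements of small cost: each element of `S` either costs `k` or uses up a part of
the deficit `∑ x ∈ T, (k - d x)` that is available in `T`,
where `k - d x` is truncated at zero. -/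
theorem mul_card_le_sum_add_sum_sub {Ω : Type*} {S T : Finset Ω} (hST : S ⊆ T)
    (d : Ω → ℕ) (k : ℕ) : k * #S ≤ ∑ x ∈ S, d x + ∑ x ∈ T, (k - d x) := by
  calc k * #S = ∑ x ∈ S, k := by simp [mul_comm]
    _ ≤ ∑ x ∈ S, (d x + (k - d x)) := sum_le_sum fun x _ => by omega
    _ ≤ _ := by
      rw [sum_add_distrib]
      exact Nat.add_le_add_left (sum_le_sum_of_subset hST) _

theorem sum_fileErrors : ∀ (m : Fin 2) (y : Database Bool 2 2),
    ∑ x, (1 - fileErrors m y x) = 4 ∧ ∑ x, (2 - fileErrors m y x) = 16 := by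
  unfold fileErrors
  decide +kernel

theorem sum_bitErrors : ∀ y : Database Bool 2 2,
    ∑ x, (1 - bitErrors y x) = 1 ∧ ∑ x, (2 - bitErrors y x) = 6 ∧
    ∑ x, (3 - bitErrors y x) = 17 ∧ ∑ x, (4 - bitErrors y x) = 32 := by
  unfold bitErrors fileErrors
  decide +kernel

/-- A ball of radius one whose centre `y` is within distance two of `z` loses at least two points to
the ball around `z`. -/
theorem sum_bitErrors_outside : ∀ y z : Database Bool 2 2, bitErrors z y ≤ 2 →
    ∑ x with 2 ≤ bitErrors z x, (2 - bitErrors y x) ≤ 4 ∧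
    ∑ x with 2 ≤ bitErrors z x, (3 - bitErrors y x) ≤ 14 := by
  unfold bitErrors fileErrors
  decide +kernel

theorem exists_common_neighbor : ∀ y z : Database Bool 2 2, bitErrors z y ≤ 2 →
    ∃ x, bitErrors y x ≤ 1 ∧ bitErrors z x ≤ 1 := by
  unfold bitErrors fileErrors
  decide +kernel

/-- Each coordinate contributes at most two to the perimeter. Hence no three points of the cube have
pairwise distances at least three. -/
theorem triangle_perimeter (x y z : Database Bool 2 2) :
    bitErrors x y + bitErrors x z + bitErrors y z ≤ 8 := by
  have h : ∀ a b c : Bool, (if b = a then 0 else 1) + (if c = a then 0 else 1) +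
      (if c = b then 0 else 1) ≤ 2 := by decide
  have h00 := h (x 0 0) (y 0 0) (z 0 0)
  have h01 := h (x 0 1) (y 0 1) (z 0 1)
  have h10 := h (x 1 0) (y 1 0) (z 1 0)
  have h11 := h (x 1 1) (y 1 1) (z 1 1)
  simp only [bitErrors, fileErrors, Fin.sum_univ_two]
  omega

/-! ### Potentials on code trees -/

/-- The function with the table `T`: row `z`, column `t`, and `0` outside of the table. -/
def tablePotential (T : List (List ℕ)) (z t : ℕ) : ℕ :=
  (T.getD z []).getD t 0

/-- `G z t` is compatible with splitting a node of a code tree in two, when `t` of the 16 databases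
and `z` of the at most `n` marked ones pass through the node, and each letter of a codeword costs
`p`. -/
def IsCodePotential (p n : ℕ) (G : ℕ → ℕ → ℕ) : Prop :=
  G 0 0 = 0 ∧ ∀ z₁ ≤ n, ∀ z₂ ≤ n, ∀ t₁ ≤ 16, ∀ t₂ ≤ 16,
    (z₁ + z₂ ≤ n ∧ t₁ + t₂ ≤ 16 ∧ z₁ ≤ t₁ ∧ z₂ ≤ t₂) →
      G (z₁ + z₂) (t₁ + t₂) ≤ p * (t₁ + t₂) + G z₁ t₁ + G z₂ t₂

set_option synthInstance.maxSize 4000 in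
instance (p n : ℕ) (G : ℕ → ℕ → ℕ) : Decidable (IsCodePotential p n G) := by
  unfold IsCodePotential
  infer_instance

theorem card_database : Fintype.card (Database Bool 2 2) = 16 := by
  simp

open Finset in
theorem IsCodePotential.le_of_prefixFreeOn {α : Type*} {p n l : ℕ} {G : ℕ → ℕ → ℕ}
    (hG : IsCodePotential p n G) (f : Database Bool 2 2 → α) (c : α → List Bool)
    (hc : PrefixFreeOn c (Set.range f)) (d : α → Database Bool 2 2 → ℕ)
    (Z : Finset (Database Bool 2 2)) (hZ : #Z ≤ n)
    (hleaf : ∀ (a : α) (S : Finset (Database Bool 2 2)), S.Nonempty → #S ≤ 16 →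
      (∀ x ∈ S, f x = a) → G #(S ∩ Z) #S ≤ l * ∑ x ∈ S, d a x) :
    G #Z 16 ≤ p * ∑ x, (c (f x)).length + l * ∑ x, d (f x) x := by
  classical
  have h := potential_le_sum_length_add_cost p 16 Z G f (fun x => l * d (f x) x) hG.1
    (fun z₁ z₂ t₁ t₂ hz ht h₁ h₂ => hG.2 z₁ (by omega) z₂ (by omega) t₁ (by omega) t₂ (by omega)
      ⟨hz.trans hZ, ht, h₁, h₂⟩) ?_ (univ.sup fun x => (c (f x)).length) (fun x => c (f x)) univ
    (by simp) (fun x _ => le_sup (f := fun x => (c (f x)).length) (mem_univ x)) ?_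
  · rwa [univ_inter, card_univ, card_database, sum_add_distrib, ← mul_sum, ← mul_sum] at h
  · rintro S ⟨x₀, hx₀⟩ hS hf
    rw [← mul_sum, sum_congr rfl fun x hx => by rw [hf x hx x₀ hx₀]]
    exact hleaf (f x₀) S ⟨x₀, hx₀⟩ hS fun x hx => hf x hx x₀ hx₀
  · intro x _ x' _ hpre
    by_contra hne
    exact hc _ ⟨x, rfl⟩ _ ⟨x', rfl⟩ hne hpre

open Finset in
/-- A cell of size `t` has at least as many errors as the `t` points nearest to a point of the cube,
of which 1, 4, 6, 4, 1 are at distance 0, 1, 2, 3, 4. -/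
theorem max_le_sum_bitErrors (y : Database Bool 2 2) (S : Finset (Database Bool 2 2)) :
    max (max (#S - 1) (2 * #S - 6)) (max (3 * #S - 17) (4 * #S - 32)) ≤
      ∑ x ∈ S, bitErrors y x := by
  obtain ⟨h1, h2, h3, h4⟩ := sum_bitErrors y
  have k1 := mul_card_le_sum_add_sum_sub (subset_univ S) (bitErrors y) 1
  have k2 := mul_card_le_sum_add_sum_sub (subset_univ S) (bitErrors y) 2
  have k3 := mul_card_le_sum_add_sum_sub (subset_univ S) (bitErrors y) 3
  have k4 := mul_card_le_sum_add_sum_sub (subset_univ S) (bitErrors y) 4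
  omega

open Finset in
/-- The case without marked databases, where the cost of a cell is bounded in terms of its size
alone. -/
theorem IsCodePotential.le_of_cost_of_card {p l : ℕ} {G : ℕ → ℕ → ℕ} {φ : ℕ → ℕ}
    (hG : IsCodePotential p 0 G) (hφ : ∀ t ≤ 16, G 0 t ≤ l * φ t)
    {α : Type*} (f : Database Bool 2 2 → α) (c : α → List Bool)
    (hc : PrefixFreeOn c (Set.range f))
    (d : α → Database Bool 2 2 → ℕ) (hd : ∀ a S, φ #S ≤ ∑ x ∈ S, d a x) :
    G 0 16 ≤ p * ∑ x, (c (f x)).length + l * ∑ x, d (f x) x := by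
  refine hG.le_of_prefixFreeOn f c hc d ∅ (by simp) fun a S _ hS _ => ?_
  rw [inter_empty, card_empty]
  exact (hφ _ hS).trans (Nat.mul_le_mul_left _ (hd a S))

/-! ### The trade-off between code length and errors for one query

The rows of the tables are computed by dynamic programming: the entry for `t` databases is the
minimum of `l` times the bound for the errors of a cell of size `t`, if there are no two marked
databases in it, and of `p * t` plus the sum of two entries, over all ways of splitting the `t`
databases, and the marked ones among them, in two. -/

open Finset in
theorem length_add_two_fileErrors {α : Type*} (f : Database Bool 2 2 → α) (c : α → List Bool)
    (hc : PrefixFreeOn c (Set.range f)) (y : α → Database Bool 2 2) (m : Fin 2) :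
    32 ≤ ∑ x, (c (f x)).length + 2 * ∑ x, fileErrors m (y (f x)) x := by
  rw [← one_mul (∑ x, (c (f x)).length)]
  refine IsCodePotential.le_of_cost_of_card (φ := fun t => max (t - 4) (2 * t - 16))
    (G := tablePotential [[0, 0, 0, 0, 0, 2, 4, 6, 8, 10, 12, 14, 16, 20, 24, 28, 32]])
    (by decide +kernel) (by decide +kernel) f c hc (fun a => fileErrors m (y a)) fun a S => ?_
  obtain ⟨h1, h2⟩ := sum_fileErrors m (y a)
  have k1 := mul_card_le_sum_add_sum_sub (subset_univ S) (fileErrors m (y a)) 1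
  have k2 := mul_card_le_sum_add_sum_sub (subset_univ S) (fileErrors m (y a)) 2
  omega

theorem four_length_add_eleven_bitErrors {α : Type*} (f : Database Bool 2 2 → α) (c : α → List Bool)
    (hc : PrefixFreeOn c (Set.range f)) (y : α → Database Bool 2 2) :
    256 ≤ 4 * ∑ x, (c (f x)).length + 11 * ∑ x, bitErrors (y (f x)) x :=
  IsCodePotential.le_of_cost_of_card
    (φ := fun t => max (max (t - 1) (2 * t - 6)) (max (3 * t - 17) (4 * t - 32)))
    (G := tablePotential [[0, 0, 8, 20, 32, 44, 64, 80, 96, 112, 128,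
      152, 172, 192, 212, 232, 256]])
    (by decide +kernel) (by decide +kernel) f c hc (fun a => bitErrors (y a))
    fun a S => max_le_sum_bitErrors (y a) S

theorem three_length_add_four_bitErrors {α : Type*} (f : Database Bool 2 2 → α) (c : α → List Bool)
    (hc : PrefixFreeOn c (Set.range f)) (y : α → Database Bool 2 2) :
    128 ≤ 3 * ∑ x, (c (f x)).length + 4 * ∑ x, bitErrors (y (f x)) x :=
  IsCodePotential.le_of_cost_of_card
    (φ := fun t => max (max (t - 1) (2 * t - 6)) (max (3 * t - 17) (4 * t - 32)))
    (G := tablePotential [[0, 0, 4, 8, 12, 16, 24, 32, 40, 48, 56, 64, 76, 88, 100, 112, 128]])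
    (by decide +kernel) (by decide +kernel) f c hc (fun a => bitErrors (y a))
    fun a S => max_le_sum_bitErrors (y a) S

open Finset in
/-- The case of two answers `a`, `b` that are given on the whole ball of radius one around their
reconstructions. The centres are marked. A cell without marked points then has less than four
points within distance one of its reconstruction, or four but not the reconstruction itself, and no
cell contains both centres. -/
theorem le_of_two_full_balls {α : Type*} (f : Database Bool 2 2 → α) (c : α → List Bool)
    (hc : PrefixFreeOn c (Set.range f)) (y : α → Database Bool 2 2)
    {p l : ℕ} {G : ℕ → ℕ → ℕ} (hG : IsCodePotential p 2 G)
    (hG1 : ∀ t ≤ 16, G 1 t ≤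
      l * max (max (t - 1) (2 * t - 6)) (max (3 * t - 17) (4 * t - 32)))
    (hG0 : ∀ t ≤ 16, G 0 t ≤ l * max (t - 1) (max (2 * t - 4) (3 * t - 14)))
    {a b : α} (hab : a ≠ b) (ha : ∀ x, bitErrors (y a) x ≤ 1 → f x = a)
    (hb : ∀ x, bitErrors (y b) x ≤ 1 → f x = b) :
    G 2 16 ≤ p * ∑ x, (c (f x)).length + l * ∑ x, bitErrors (y (f x)) x := by
  have hself : ∀ z, bitErrors z z ≤ 1 := fun z => by simp [bitErrors, fileErrors]
  have hfar : 3 ≤ bitErrors (y a) (y b) := by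
    by_contra! h
    obtain ⟨x, hx, hx'⟩ := exists_common_neighbor (y b) (y a) (by omega)
    exact hab ((ha x hx').symm.trans (hb x hx))
  have hne : y a ≠ y b := fun h => by
    have := hself (y b)
    rw [h] at hfar
    omega
  have hZ : #{y a, y b} = 2 := card_pair hne
  suffices h : G #{y a, y b} 16 ≤ p * ∑ x, (c (f x)).length + l * ∑ x, bitErrors (y (f x)) x by
    rwa [hZ] at h
  refine hG.le_of_prefixFreeOn f c hc (fun a => bitErrors (y a)) {y a, y b} hZ.le ?_
  intro e S _ hS hf
  by_cases hz : y a ∈ S ∨ y b ∈ S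
  · have h1 : #(S ∩ {y a, y b}) = 1 := by
      rcases hz with h | h
      · have h' : y b ∉ S := fun h' =>
          hab ((ha _ (hself _)).symm.trans ((hf _ h).trans ((hf _ h').symm.trans (hb _ (hself _)))))
        rw [inter_comm, insert_inter_of_mem h, singleton_inter_of_notMem h']
        rfl
      · have h' : y a ∉ S := fun h' =>
          hab ((ha _ (hself _)).symm.trans ((hf _ h').trans ((hf _ h).symm.trans (hb _ (hself _)))))
        rw [inter_comm, insert_inter_of_notMem h', singleton_inter_of_mem h]
        rfl
    rw [h1]
    exact (hG1 _ hS).trans (Nat.mul_le_mul_left _ (max_le_sum_bitErrors _ _))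
  · push Not at hz
    have h1 : #(S ∩ {y a, y b}) = 0 := by
      rw [inter_comm, insert_inter_of_notMem hz.1, singleton_inter_of_notMem hz.2]
      rfl
    rw [h1]
    refine (hG0 _ hS).trans (Nat.mul_le_mul_left _ ?_)
    obtain ⟨T, hT, hT2, hT3⟩ : ∃ T, S ⊆ T ∧ ∑ x ∈ T, (2 - bitErrors (y e) x) ≤ 4 ∧
        ∑ x ∈ T, (3 - bitErrors (y e) x) ≤ 14 := by
      have hpunct : y e ∉ S → ∃ T, S ⊆ T ∧ ∑ x ∈ T, (2 - bitErrors (y e) x) ≤ 4 ∧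
        ∑ x ∈ T, (3 - bitErrors (y e) x) ≤ 14 := by
        intro he
        obtain ⟨-, h2, h3, -⟩ := sum_bitErrors (y e)
        have h0 : bitErrors (y e) (y e) = 0 := by simp [bitErrors, fileErrors]
        refine ⟨univ.erase (y e), fun x hx => mem_erase.2 ⟨fun h => he (h ▸ hx), mem_univ _⟩,
          ?_, ?_⟩
        · have := add_sum_erase univ (fun x => 2 - bitErrors (y e) x) (mem_univ (y e))
          simp only [h0] at this
          omega
        · have := add_sum_erase univ (fun x => 3 - bitErrors (y e) x) (mem_univ (y e))
          simp only [h0] at this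
          omega
      by_cases hea : e = a
      · exact hpunct (hea ▸ hz.1)
      by_cases heb : e = b
      · exact hpunct (heb ▸ hz.2)
      have hout : ∀ g, (∀ x, bitErrors (y g) x ≤ 1 → f x = g) → e ≠ g →
          bitErrors (y g) (y e) ≤ 2 → ∃ T, S ⊆ T ∧ ∑ x ∈ T, (2 - bitErrors (y e) x) ≤ 4 ∧
            ∑ x ∈ T, (3 - bitErrors (y e) x) ≤ 14 := by
        intro g hg heg hd
        refine ⟨_, fun x hx => mem_filter.2 ⟨mem_univ _, ?_⟩, sum_bitErrors_outside _ _ hd⟩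
        by_contra! h
        exact heg ((hf x hx).symm.trans (hg x (by omega)))
      -- the centres `y a` and `y b` are at distance at least three, so `y e` is near one of them
      have := triangle_perimeter (y a) (y b) (y e)
      by_cases hda : bitErrors (y a) (y e) ≤ 2
      · exact hout a ha hea hda
      · exact hout b hb heb (by omega)
    have k1 := max_le_sum_bitErrors (y e) S
    have k2 := mul_card_le_sum_add_sum_sub hT (bitErrors (y e)) 2
    have k3 := mul_card_le_sum_add_sum_sub hT (bitErrors (y e)) 3
    omega

open Finset in
/-- The case of at most one answer that is given on the whole ball of radius one around its
reconstruction. The centre of this ball, if it exists, is marked. A cell without marked points then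
misses a point of the ball around its reconstruction. -/
theorem le_of_subsingleton_full_balls {α : Type*} (f : Database Bool 2 2 → α) (c : α → List Bool)
    (hc : PrefixFreeOn c (Set.range f)) (y : α → Database Bool 2 2)
    {p l k : ℕ} {G : ℕ → ℕ → ℕ} (hG : IsCodePotential p 1 G)
    (hG1 : ∀ t ≤ 16, G 1 t ≤
      l * max (max (t - 1) (2 * t - 6)) (max (3 * t - 17) (4 * t - 32)))
    (hG0 : ∀ t ≤ 16, G 0 t ≤ l * max (t - 1) (max (2 * t - 5) (3 * t - 15)))
    (hk : k ≤ G 0 16 ∧ k ≤ G 1 16)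
    (huniq : ∀ a b, (∀ x, bitErrors (y a) x ≤ 1 → f x = a) →
      (∀ x, bitErrors (y b) x ≤ 1 → f x = b) → a = b) :
    k ≤ p * ∑ x, (c (f x)).length + l * ∑ x, bitErrors (y (f x)) x := by
  classical
  have hself : ∀ z, bitErrors z z ≤ 1 := fun z => by simp [bitErrors, fileErrors]
  set Z : Finset (Database Bool 2 2) :=
    univ.filter fun z => z = y (f z) ∧ ∀ x, bitErrors z x ≤ 1 → f x = f z with hZdef
  have hZ : #Z ≤ 1 := by
    refine card_le_one.2 fun z hz z' hz' => ?_
    rw [hZdef, mem_filter] at hz hz'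
    have := huniq (f z) (f z') (by rw [← hz.2.1]; exact hz.2.2) (by rw [← hz'.2.1]; exact hz'.2.2)
    rw [hz.2.1, this, ← hz'.2.1]
  refine le_trans ?_ (hG.le_of_prefixFreeOn f c hc (fun a => bitErrors (y a)) Z hZ ?_)
  · rcases Nat.le_one_iff_eq_zero_or_eq_one.1 hZ with h | h <;> rw [h]
    exacts [hk.1, hk.2]
  intro e S _ hS hf
  rcases Nat.le_one_iff_eq_zero_or_eq_one.1 ((card_le_card inter_subset_right).trans hZ)
    with h | h <;> rw [h]
  · refine (hG0 _ hS).trans (Nat.mul_le_mul_left _ ?_)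
    obtain ⟨x₀, hx₀, hx₀S⟩ : ∃ x₀, bitErrors (y e) x₀ ≤ 1 ∧ x₀ ∉ S := by
      by_contra! hall
      have hmem : y e ∈ S ∩ Z := by
        have hye := hall _ (hself (y e))
        have hfe := hf _ hye
        refine mem_inter.2 ⟨hye, mem_filter.2 ⟨mem_univ _, by rw [hfe], fun x hx => ?_⟩⟩
        rw [hfe, hf x (hall x hx)]
      rw [card_eq_zero.1 h] at hmem
      exact notMem_empty _ hmem
    have hT : S ⊆ univ.erase x₀ := fun x hx => mem_erase.2 ⟨fun h => hx₀S (h ▸ hx), mem_univ _⟩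
    obtain ⟨-, h2, h3, -⟩ := sum_bitErrors (y e)
    have e2 := add_sum_erase univ (fun x => 2 - bitErrors (y e) x) (mem_univ x₀)
    have e3 := add_sum_erase univ (fun x => 3 - bitErrors (y e) x) (mem_univ x₀)
    have k1 := max_le_sum_bitErrors (y e) S
    have k2 := mul_card_le_sum_add_sum_sub hT (bitErrors (y e)) 2
    have k3 := mul_card_le_sum_add_sum_sub hT (bitErrors (y e)) 3
    omega
  · exact (hG1 _ hS).trans (Nat.mul_le_mul_left _ (max_le_sum_bitErrors _ _))

/-- The sizes of the cells alone do not give this bound: cells of sizes 5, 5, 6 with 4, 4, 6 errors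
would violate it, but two balls of size 5 do not leave room for the third cell. -/
theorem length_add_two_bitErrors {α : Type*} (f : Database Bool 2 2 → α) (c : α → List Bool)
    (hc : PrefixFreeOn c (Set.range f)) (y : α → Database Bool 2 2) :
    56 ≤ ∑ x, (c (f x)).length + 2 * ∑ x, bitErrors (y (f x)) x := by
  rw [← one_mul (∑ x, (c (f x)).length)]
  by_cases h : ∃ a b, a ≠ b ∧ (∀ x, bitErrors (y a) x ≤ 1 → f x = a) ∧
    ∀ x, bitErrors (y b) x ≤ 1 → f x = b
  · obtain ⟨a, b, hab, ha, hb⟩ := h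
    exact le_of_two_full_balls (G := tablePotential
      [[0, 0, 2, 4, 8, 11, 14, 19, 23, 27, 32, 36, 40, 46, 51, 56, 62],
       [0, 0, 2, 4, 6, 8, 12, 16, 20, 24, 28, 32, 38, 43, 48, 53, 58],
       [0, 0, 2, 5, 8, 11, 14, 17, 20, 23, 26, 31, 36, 41, 46, 51, 56]])
      f c hc y (by decide +kernel) (by decide +kernel) (by decide +kernel) hab ha hb
  · exact le_of_subsingleton_full_balls (G := tablePotential
      [[0, 0, 2, 4, 6, 10, 14, 17, 20, 25, 30, 34, 38, 43, 48, 52, 56],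
       [0, 0, 2, 4, 6, 8, 12, 16, 20, 23, 28, 32, 37, 41, 46, 51, 56]])
      f c hc y (by decide +kernel) (by decide +kernel) (by decide +kernel) (by decide +kernel)
      fun a b ha hb => by_contra fun hab => h ⟨a, b, hab, ha, hb⟩

/-- As in `length_add_two_bitErrors`, the sizes of the cells do not suffice: sizes 5, 5, 4, 1, 1 with
4, 4, 3, 0, 0 errors would violate the bound. -/
theorem two_length_add_five_bitErrors {α : Type*} (f : Database Bool 2 2 → α) (c : α → List Bool)
    (hc : PrefixFreeOn c (Set.range f)) (y : α → Database Bool 2 2) :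
    124 ≤ 2 * ∑ x, (c (f x)).length + 5 * ∑ x, bitErrors (y (f x)) x := by
  by_cases h : ∃ a b, a ≠ b ∧ (∀ x, bitErrors (y a) x ≤ 1 → f x = a) ∧
    ∀ x, bitErrors (y b) x ≤ 1 → f x = b
  · obtain ⟨a, b, hab, ha, hb⟩ := h
    exact le_of_two_full_balls (G := tablePotential
      [[0, 0, 4, 10, 16, 24, 32, 40, 48, 58, 68, 78, 88, 98, 108, 118, 128],
       [0, 0, 4, 10, 15, 20, 30, 38, 46, 54, 64, 74, 84, 94, 106, 116, 126],
       [0, 0, 4, 10, 16, 24, 31, 38, 46, 53, 60, 72, 82, 92, 102, 114, 124]])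
      f c hc y (by decide +kernel) (by decide +kernel) (by decide +kernel) hab ha hb
  · exact le_of_subsingleton_full_balls (G := tablePotential
      [[0, 0, 4, 10, 15, 24, 31, 39, 46, 57, 66, 76, 85, 96, 105, 115, 124],
       [0, 0, 4, 10, 15, 20, 30, 38, 46, 53, 64, 73, 83, 92, 104, 114, 124]])
      f c hc y (by decide +kernel) (by decide +kernel) (by decide +kernel) (by decide +kernel)
      fun a b ha hb => by_contra fun hab => h ⟨a, b, hab, ha, hb⟩

/-! ### The lower bound for all schemes -/

namespace LWPIRScheme

theorem prob_le_iSup_prob (S : LWPIRScheme Bool 2 2) (q : S.Query) (m : Fin 2) :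
    S.prob q m ≤ ⨆ m, S.prob q m :=
  le_ciSup (f := S.prob q) (Set.finite_range _).bddAbove m

theorem fileDistortion_eq_sum_fileErrors (S : LWPIRScheme Bool 2 2) (m : Fin 2) :
    S.fileDistortion hammingDistortion m = ∑ q, S.prob q m *
      (((∑ x, fileErrors m (fun j => S.estimate j q (S.answer q x)) x : ℕ) : ℝ) / 32) := by
  rw [fileDistortion, Finset.sum_comm, Finset.sum_div]
  refine Finset.sum_congr rfl fun q _ => ?_
  rw [← Finset.mul_sum, ← Finset.sum_div, Finset.sum_comm, card_database]
  simp only [fileErrors, hammingDistortion]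
  push_cast
  ring

/-- A supporting plane of the rate function. The cost of a query with given answers is homogeneous
and piecewise linear in the two probabilities `P(q | m)`, with a kink on the diagonal, so it is
enough to consider a query that is asked for one file only, where `hlam` suffices, and a query that
is asked equally often for both files, which is the hypothesis `hpair`. -/
theorem le_rate_add_distortion_add_leakage (S : LWPIRScheme Bool 2 2) {lam mu : ℝ}
    (hlam : 2 ≤ lam) (hmu : 0 ≤ mu)
    (hpair : ∀ q, ∀ c : S.Answer → List Bool, PrefixFreeOn c (Set.range (S.answer q)) →
      1 + mu / 2 ≤ ((∑ x, (c (S.answer q x)).length : ℕ) : ℝ) / 32 + lam *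
        (((∑ x, bitErrors (fun m => S.estimate m q (S.answer q x)) x : ℕ) : ℝ) / 64)) :
    1 + mu ≤ S.rate + lam * S.distortion hammingDistortion + mu * S.leakage := by
  have hsum := S.prob_sum
  have hterm : ∀ q, (1 + mu) * ((S.prob q 0 + S.prob q 1) / 2) ≤
      S.queryProb q * optimalLength (S.answer q) / 2 + lam * ((∑ m, S.prob q m *
      (((∑ x, fileErrors m (fun j => S.estimate j q (S.answer q x)) x : ℕ) : ℝ) / 32)) / 2) +
      mu * ((⨆ m, S.prob q m) / 2) := by
    intro q
    obtain ⟨c, hc, hl⟩ := (optimalLength_attained (S.answer q)).1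
    have hsup0 := S.prob_le_iSup_prob q 0
    have hsup1 := S.prob_le_iSup_prob q 1
    have hp0 := S.prob_nonneg q 0
    have hp1 := S.prob_nonneg q 1
    have h0 : (32 : ℝ) ≤ _ := Nat.cast_le (α := ℝ).2 (length_add_two_fileErrors (S.answer q) c hc
      (fun a m => S.estimate m q a) 0)
    have h1 : (32 : ℝ) ≤ _ := Nat.cast_le (α := ℝ).2 (length_add_two_fileErrors (S.answer q) c hc
      (fun a m => S.estimate m q a) 1)
    have h2 := hpair q c hc
    rw [expectedLength, card_database, ← Nat.cast_sum] at hl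
    rw [hl, queryProb]
    simp only [bitErrors, Fin.sum_univ_two, Finset.sum_add_distrib] at h2 ⊢
    rw [Nat.cast_add] at h0 h1 h2
    rw [Nat.cast_mul] at h0 h1
    set Λ : ℝ := ((∑ x, (c (S.answer q x)).length : ℕ) : ℝ)
    set E₀ : ℝ := ((∑ x, fileErrors 0 (fun m => S.estimate m q (S.answer q x)) x : ℕ) : ℝ)
    set E₁ : ℝ := ((∑ x, fileErrors 1 (fun m => S.estimate m q (S.answer q x)) x : ℕ) : ℝ)
    have hE₀' : 0 ≤ E₀ := Nat.cast_nonneg _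
    have hE₁' : 0 ≤ E₁ := Nat.cast_nonneg _
    push_cast at h0 h1 ⊢
    have g0 : 0 ≤ Λ / 32 + lam * (E₀ / 32) - 1 := by nlinarith
    have g1 : 0 ≤ Λ / 32 + lam * (E₁ / 32) - 1 := by nlinarith
    have g2 : 0 ≤ Λ / 32 + lam * ((E₀ + E₁) / 64) + mu / 2 - (1 + mu) := by linarith
    have hm := mul_le_mul_of_nonneg_left hsup0 hmu
    have hm' := mul_le_mul_of_nonneg_left hsup1 hmu
    -- `(p₀, p₁)` is a combination of `(1, 1)` and of `(0, 1)` or `(1, 0)`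
    rcases le_total (S.prob q 0) (S.prob q 1) with h | h
    · have k1 := mul_nonneg hp0 g2
      have k2 := mul_nonneg (sub_nonneg.2 h) g1
      nlinarith
    · have k1 := mul_nonneg hp1 g2
      have k2 := mul_nonneg (sub_nonneg.2 h) g0
      nlinarith
  have htot := Finset.sum_le_sum fun q (_ : q ∈ Finset.univ) => hterm q
  have hL : ∑ q, (1 + mu) * ((S.prob q 0 + S.prob q 1) / 2) = 1 + mu := by
    rw [← Finset.mul_sum, ← Finset.sum_div, Finset.sum_add_distrib, hsum, hsum]
    norm_num
  have hR : S.rate + lam * S.distortion hammingDistortion + mu * S.leakage =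
      ∑ q, (S.queryProb q * optimalLength (S.answer q) / 2 + lam * ((∑ m, S.prob q m *
      (((∑ x, fileErrors m (fun j => S.estimate j q (S.answer q x)) x : ℕ) : ℝ) / 32)) / 2) +
      mu * ((⨆ m, S.prob q m) / 2)) := by
    simp only [Finset.sum_add_distrib, ← Finset.mul_sum, ← Finset.sum_div]
    rw [rate, distortion, leakage, Finset.sum_comm]
    simp only [fileDistortion_eq_sum_fileErrors, Nat.cast_ofNat]
  rw [hR, ← hL]
  exact htot

end LWPIRScheme

/-! ### Optimal queries -/

/-- The value that at least two of three bits have. -/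
def majority (a b c : Bool) : Bool := a && b || b && c || a && c

/-- The two files with bits `a b` and `c d`. -/
def databaseOfBits (a b c d : Bool) : Database Bool 2 2 := ![![a, b], ![c, d]]

/-- The codeword for the partition of the cube into the two balls of radius one around `0000` and
`1111` and six single points of weight two. This is a Huffman code: the balls have words of length
two, two of the single points have words of length three, and four of them of length four. -/
def twoBallWord (a b c d : Bool) : List Bool :=
  if a.toNat + b.toNat + c.toNat + d.toNat ≤ 1 then [false, false]
  else if 3 ≤ a.toNat + b.toNat + c.toNat + d.toNat then [false, true]
  else if a = b then [true, a, a]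
  else [true, a, b, c]

/-- The centre of the cell with a given word in the code `twoBallWord`. -/
def twoBallDatabase : List Bool → Database Bool 2 2
  | [true, a, _] => databaseOfBits a a (!a) (!a)
  | [true, a, b, c] => databaseOfBits a b c (!c)
  | [_, a] => databaseOfBits a a a a
  | _ => databaseOfBits false false false false

/-- The codewords of the answers to five queries: the whole database; the
code `twoBallWord`; a perfect code on three bits, the fourth bit being sent along; the same without
the fourth bit; nothing. -/
def privateWord (i : Fin 5) (x : Database Bool 2 2) : List Bool :=
  ![[x 0 0, x 0 1, x 1 0, x 1 1],
    twoBallWord (x 0 0) (x 0 1) (x 1 0) (x 1 1),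
    [majority (x 0 0) (x 0 1) (x 1 0), x 1 1],
    [majority (x 0 0) (x 0 1) (x 1 0)],
    []] i

/-- The reconstruction of the database from the answer to the query `i` of `privateWord`. -/
def privateEstimate (i : Fin 5) (v : List Bool) : Database Bool 2 2 :=
  let bit (k : ℕ) : Bool := v.getD k false
  ![databaseOfBits (bit 0) (bit 1) (bit 2) (bit 3),
    twoBallDatabase v,
    databaseOfBits (bit 0) (bit 0) (bit 0) (bit 1),
    databaseOfBits (bit 0) (bit 0) (bit 0) false,
    databaseOfBits false false false false] i

/-- Equal words come from the same answer, as the word itself is taken to be the answer. -/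
theorem privateWord_prefix_free : ∀ (i : Fin 5) (x x' : Database Bool 2 2),
    privateWord i x <+: privateWord i x' → privateWord i x = privateWord i x' := by
  decide +kernel

theorem sum_length_privateWord : ∀ i : Fin 5,
    ∑ x, (privateWord i x).length = (![64, 42, 32, 16, 0] : Fin 5 → ℕ) i := by
  decide +kernel

theorem sum_bitErrors_privateEstimate : ∀ i : Fin 5,
    ∑ x, bitErrors (privateEstimate i (privateWord i x)) x =
      (![0, 8, 12, 20, 32] : Fin 5 → ℕ) i := by
  unfold bitErrors fileErrors
  decide +kernel

theorem optimalLength_le_of_prefix_free {Ω : Type*} [Fintype Ω] (f : Ω → List Bool)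
    (hf : ∀ x x', f x <+: f x' → f x = f x') :
    optimalLength f ≤ ((∑ x, (f x).length : ℕ) : ℝ) / Fintype.card Ω := by
  refine (optimalLength_attained f).2 ⟨id, ?_, ?_⟩
  · rintro _ ⟨x, rfl⟩ _ ⟨x', rfl⟩ hne hpre
    exact hne (hf x x' hpre)
  · simp [expectedLength]

/-- The scheme that asks for the desired file itself with probability `w₀`, and with probability
`w i`, whichever file is desired, the query `i` of `privateWord`. -/
noncomputable def mixedScheme (w₀ : ℝ) (w : Fin 5 → ℝ) (hw₀ : 0 ≤ w₀) (hw : ∀ i, 0 ≤ w i)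
    (hsum : w₀ + ∑ i, w i = 1) : LWPIRScheme Bool 2 2 where
  Query := Fin 2 ⊕ Fin 5
  Answer := List Bool
  prob q m := Sum.elim (fun j => if j = m then w₀ else 0) w q
  prob_nonneg q m := by
    rcases q with j | i
    · dsimp only [Sum.elim_inl]
      split_ifs <;> first | exact hw₀ | exact le_rfl
    · exact hw i
  prob_sum m := by simpa [Fintype.sum_sum_type] using hsum
  answer q x := Sum.elim (fun j => [x j 0, x j 1]) (fun i => privateWord i x) q
  estimate m q v := Sum.elim (fun _ k => v.getD k false) (fun i => privateEstimate i v m) q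

section mixed
variable (w₀ : ℝ) (w : Fin 5 → ℝ) (hw₀ : 0 ≤ w₀) (hw : ∀ i, 0 ≤ w i)
    (hsum : w₀ + ∑ i, w i = 1)

theorem leakage_mixedScheme :
    (mixedScheme w₀ w hw₀ hw hsum).leakage = (1 + w₀) / 2 := by
  have h1 : ∀ j : Fin 2, (⨆ m, if j = m then w₀ else 0) = w₀ := by
    intro j
    refine le_antisymm (ciSup_le fun m => ?_) ?_
    · split_ifs <;> first | exact le_rfl | exact hw₀
    · simpa using le_ciSup (f := fun m => if j = m then w₀ else 0) (Set.finite_range _).bddAbove j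
  rw [LWPIRScheme.leakage]
  change (∑ q : Fin 2 ⊕ Fin 5, ⨆ m, Sum.elim (fun j => if j = m then w₀ else 0) w q) / _ = _
  rw [Fintype.sum_sum_type]
  simp only [Sum.elim_inl, Sum.elim_inr, h1, ciSup_const, Fin.sum_univ_two, Nat.cast_ofNat]
  linarith

theorem distortion_mixedScheme :
    (mixedScheme w₀ w hw₀ hw hsum).distortion hammingDistortion =
      (8 * w 1 + 12 * w 2 + 20 * w 3 + 32 * w 4) / 64 := by
  have hfile : ∀ m, (mixedScheme w₀ w hw₀ hw hsum).fileDistortion hammingDistortion m =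
      ∑ i, w i * (((∑ x, fileErrors m (privateEstimate i (privateWord i x)) x : ℕ) : ℝ) / 32) := by
    intro m
    rw [LWPIRScheme.fileDistortion_eq_sum_fileErrors]
    change ∑ q : Fin 2 ⊕ Fin 5, _ = _
    refine (Fintype.sum_sum_type _).trans
      ((congrArg₂ (· + ·) (Finset.sum_eq_zero fun j _ => ?_) rfl).trans (zero_add _))
    by_cases hj : j = m
    · subst hj
      have : ∑ x : Database Bool 2 2, fileErrors j
          (fun _ k => [x j 0, x j 1].getD k false) x = 0 := by
        refine Finset.sum_eq_zero fun x _ => ?_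
        simp [fileErrors, Fin.sum_univ_two]
      refine mul_eq_zero_of_right _ ?_
      change ((∑ x : Database Bool 2 2, fileErrors j
          (fun _ k => [x j 0, x j 1].getD k false) x : ℕ) : ℝ) / 32 = 0
      rw [this]
      simp
    · exact mul_eq_zero_of_left (if_neg hj) _
  have hE := fun i => congrArg (Nat.cast (R := ℝ)) (sum_bitErrors_privateEstimate i)
  simp only [bitErrors, Fin.sum_univ_two, Finset.sum_add_distrib, Nat.cast_add] at hE
  have e0 := hE 0
  have e1 := hE 1
  have e2 := hE 2
  have e3 := hE 3
  have e4 := hE 4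
  simp only [Matrix.cons_val] at e0 e1 e2 e3 e4
  rw [LWPIRScheme.distortion, Fin.sum_univ_two, hfile, hfile, ← Finset.sum_add_distrib,
    Fin.sum_univ_five]
  simp only [← mul_add, ← add_div, e0, e1, e2, e3, e4]
  push_cast
  ring

theorem rate_mixedScheme_le :
    (mixedScheme w₀ w hw₀ hw hsum).rate ≤
      w₀ + (64 * w 0 + 42 * w 1 + 32 * w 2 + 16 * w 3) / 32 := by
  have hfile : ∀ j : Fin 2, optimalLength (fun x : Database Bool 2 2 => [x j 0, x j 1]) ≤ 2 := by
    intro j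
    refine (optimalLength_le_of_prefix_free _ fun x x' h => ?_).trans ?_
    · exact h.eq_of_length (by simp)
    · rw [card_database]
      simp
      norm_num
  have hpriv : ∀ i, optimalLength (privateWord i) ≤
      ((![64, 42, 32, 16, 0] : Fin 5 → ℕ) i : ℝ) / 16 := by
    intro i
    have := optimalLength_le_of_prefix_free _ (privateWord_prefix_free i)
    rwa [sum_length_privateWord, card_database] at this
  rw [LWPIRScheme.rate]
  change (∑ q : Fin 2 ⊕ Fin 5, ((∑ m, Sum.elim (fun j => if j = m then w₀ else 0) w q) /
    ((2 : ℕ) : ℝ)) * optimalLength (fun x : Database Bool 2 2 => Sum.elim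
      (fun j => [x j 0, x j 1]) (fun i => privateWord i x) q)) / ((2 : ℕ) : ℝ) ≤ _
  rw [Fintype.sum_sum_type]
  simp only [Sum.elim_inl, Sum.elim_inr, Finset.sum_ite_eq, Finset.mem_univ, if_true,
    Finset.sum_const, Finset.card_univ, Fintype.card_fin, Fin.sum_univ_two, Fin.sum_univ_five]
  have f0 := mul_le_mul_of_nonneg_left (hfile 0) hw₀
  have f1 := mul_le_mul_of_nonneg_left (hfile 1) hw₀
  have p0 := mul_le_mul_of_nonneg_left (hpriv 0) (hw 0)
  have p1 := mul_le_mul_of_nonneg_left (hpriv 1) (hw 1)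
  have p2 := mul_le_mul_of_nonneg_left (hpriv 2) (hw 2)
  have p3 := mul_le_mul_of_nonneg_left (hpriv 3) (hw 3)
  have p4 := mul_le_mul_of_nonneg_left (hpriv 4) (hw 4)
  simp only [Matrix.cons_val] at p0 p1 p2 p3 p4
  norm_num at p0 p1 p2 p3 p4 ⊢
  linarith
end mixed

/-! ### The minimum rate -/

/-- The supporting plane with slopes `lam` and `mu` gives the minimum rate at any point of it that a
mixture of the optimal queries attains. -/
theorem isMinimumRate_of_bounds {D L R lam mu : ℝ} (hlam : 2 ≤ lam) (hmu : 0 ≤ mu)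
    (hR : R = 1 + mu - lam * D - mu * L)
    (hpair : ∀ {α : Type} (f : Database Bool 2 2 → α) (c : α → List Bool),
      PrefixFreeOn c (Set.range f) → ∀ y : α → Database Bool 2 2,
      1 + mu / 2 ≤ ((∑ x, (c (f x)).length : ℕ) : ℝ) / 32 + lam *
        (((∑ x, bitErrors (y (f x)) x : ℕ) : ℝ) / 64))
    (w₀ : ℝ) (w : Fin 5 → ℝ) (hw₀ : 0 ≤ w₀) (hw : ∀ i, 0 ≤ w i) (hsum : w₀ + ∑ i, w i = 1)
    (hD : (8 * w 1 + 12 * w 2 + 20 * w 3 + 32 * w 4) / 64 ≤ D) (hL : (1 + w₀) / 2 ≤ L)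
    (hrate : w₀ + (64 * w 0 + 42 * w 1 + 32 * w 2 + 16 * w 3) / 32 ≤ R) :
    IsMinimumRate Bool hammingDistortion 2 2 D L R := by
  have hconv : ∀ S : LWPIRScheme Bool 2 2, S.distortion hammingDistortion ≤ D →
      S.leakage ≤ L → R ≤ S.rate := by
    intro S hSD hSL
    have h := S.le_rate_add_distortion_add_leakage hlam hmu fun q c hc =>
      hpair (S.answer q) c hc fun a m => S.estimate m q a
    have h1 := mul_le_mul_of_nonneg_left hSD (by linarith : 0 ≤ lam)
    have h2 := mul_le_mul_of_nonneg_left hSL hmu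
    linarith
  refine ⟨⟨mixedScheme w₀ w hw₀ hw hsum, ?_, ?_, ?_⟩, ?_⟩
  · rwa [distortion_mixedScheme]
  · rwa [leakage_mixedScheme]
  · refine le_antisymm ((rate_mixedScheme_le w₀ w hw₀ hw hsum).trans hrate) (hconv _ ?_ ?_)
    · rwa [distortion_mixedScheme]
    · rwa [leakage_mixedScheme]
  · rintro r ⟨S, hSD, hSL, rfl⟩
    exact hconv S hSD hSL

theorem mainTheorem5 (D L : ℝ) (hL : L ∈ Set.Icc (1 / 2 : ℝ) 1) :
    (D ∈ Set.Icc 0 ((1 - L) / 4) →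
      IsMinimumRate Bool hammingDistortion 2 2 D L (-(11 / 2) * D + 3 - 2 * L)) ∧
    (D ∈ Set.Icc ((1 - L) / 4) (3 * (1 - L) / 8) →
      IsMinimumRate Bool hammingDistortion 2 2 D L (-5 * D + (23 - 15 * L) / 8)) ∧
    (D ∈ Set.Icc (3 * (1 - L) / 8) (5 * (1 - L) / 8) →
      IsMinimumRate Bool hammingDistortion 2 2 D L (-4 * D + (5 - 3 * L) / 2)) ∧
    (D ∈ Set.Icc (5 * (1 - L) / 8) (1 - L) →
      IsMinimumRate Bool hammingDistortion 2 2 D L (-(8 / 3) * D + (5 - 2 * L) / 3)) ∧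
    (D ∈ Set.Icc (1 - L) (1 / 2) →
      IsMinimumRate Bool hammingDistortion 2 2 D L (-2 * D + 1)) := by
  obtain ⟨hL₁, hL₂⟩ := hL
  -- The leakage of the mixture is `(1 + w₀) / 2`, so `w₀ = 2 * L - 1` uses it up; the weights of the
  -- two queries that span the plane are then determined by `D`. In the last region the bound does
  -- not involve `L`, and `w₀` is determined by `D`.
  refine ⟨?_, ?_, ?_, ?_, ?_⟩ <;> rintro ⟨hD₁, hD₂⟩
  · refine isMinimumRate_of_bounds (lam := 11 / 2) (mu := 2) (by norm_num) (by norm_num) (by ring)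
      (fun f c hc y => ?_) (2 * L - 1) ![2 * (1 - L) - 8 * D, 8 * D, 0, 0, 0] (by linarith)
      (fun i => ?_) ?_ ?_ (by linarith) ?_
    · have h := Nat.cast_le (α := ℝ).2 (four_length_add_eleven_bitErrors f c hc y)
      rw [Nat.cast_add, Nat.cast_mul, Nat.cast_mul] at h
      norm_num only [Nat.cast_ofNat] at h ⊢
      linarith
    · fin_cases i <;> simp <;> linarith
    · simp [Fin.sum_univ_five]; ring
    · simp; linarith
    · simp; linarith
  · refine isMinimumRate_of_bounds (lam := 5) (mu := 15 / 8) (by norm_num) (by norm_num) (by ring)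
      (fun f c hc y => ?_) (2 * L - 1)
      ![0, 6 * (1 - L) - 16 * D, 16 * D - 4 * (1 - L), 0, 0] (by linarith)
      (fun i => ?_) ?_ ?_ (by linarith) ?_
    · have h := Nat.cast_le (α := ℝ).2 (two_length_add_five_bitErrors f c hc y)
      rw [Nat.cast_add, Nat.cast_mul, Nat.cast_mul] at h
      norm_num only [Nat.cast_ofNat] at h ⊢
      linarith
    · fin_cases i <;> simp <;> linarith
    · simp [Fin.sum_univ_five]; ring
    · simp; linarith
    · simp; linarith
  · refine isMinimumRate_of_bounds (lam := 4) (mu := 3 / 2) (by norm_num) (by norm_num) (by ring)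
      (fun f c hc y => ?_) (2 * L - 1)
      ![0, 0, 5 * (1 - L) - 8 * D, 8 * D - 3 * (1 - L), 0] (by linarith)
      (fun i => ?_) ?_ ?_ (by linarith) ?_
    · have h := Nat.cast_le (α := ℝ).2 (length_add_two_bitErrors f c hc y)
      rw [Nat.cast_add, Nat.cast_mul] at h
      norm_num only [Nat.cast_ofNat] at h ⊢
      linarith
    · fin_cases i <;> simp <;> linarith
    · simp [Fin.sum_univ_five]; ring
    · simp; linarith
    · simp; linarith
  · refine isMinimumRate_of_bounds (lam := 8 / 3) (mu := 2 / 3) (by norm_num) (by norm_num)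
      (by ring) (fun f c hc y => ?_) (2 * L - 1)
      ![0, 0, 0, 16 / 3 * (1 - L) - 16 / 3 * D, 16 / 3 * D - 10 / 3 * (1 - L)] (by linarith)
      (fun i => ?_) ?_ ?_ (by linarith) ?_
    · have h := Nat.cast_le (α := ℝ).2 (three_length_add_four_bitErrors f c hc y)
      rw [Nat.cast_add, Nat.cast_mul, Nat.cast_mul] at h
      norm_num only [Nat.cast_ofNat] at h ⊢
      linarith
    · fin_cases i <;> simp <;> linarith
    · simp [Fin.sum_univ_five]; ring
    · simp; linarith
    · simp; linarith
  · refine isMinimumRate_of_bounds (lam := 2) (mu := 0) (by norm_num) (by norm_num) (by ring)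
      (fun f c hc y => ?_) (1 - 2 * D) ![0, 0, 0, 0, 2 * D] (by linarith)
      (fun i => ?_) ?_ ?_ (by linarith) ?_
    · have h0 := Nat.cast_le (α := ℝ).2 (length_add_two_fileErrors f c hc y 0)
      have h1 := Nat.cast_le (α := ℝ).2 (length_add_two_fileErrors f c hc y 1)
      rw [Nat.cast_add, Nat.cast_mul] at h0 h1
      simp only [bitErrors, Fin.sum_univ_two, Finset.sum_add_distrib, Nat.cast_add]
      norm_num only [Nat.cast_ofNat] at h0 h1 ⊢
      linarith
    · fin_cases i <;> simp
      linarith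
    · simp [Fin.sum_univ_five]
    · simp; linarith
    · simp
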